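/- Let $\Lambda$ be a finite-dimensional algebra over a field, with Jacobson radical $J$. Let $e,f\in\Lambda$ be primitive idempotents, let $0\neq a\in fJe$, and suppose that the left $\Lambda$-module $U=\Lambda e/\Lambda a$ is uniserial, i.e. has exactly one composition series. Let $$0\longrightarrow A\longrightarrow B\longrightarrow U\longrightarrow 0$$ be an almost split sequence ending in $U$ in the category of finitely generated left $\Lambda$-modules. Then $\alpha(U)\le 2$, where $\alpha(U)$ is the number of summands in a decomposition of $B$ into a direct sum of indecomposable modules; that is, $B$ is a direct sum of at most two indecomposable modules, and every decomposition of $B$ as a finite direct sum of indecomposable modules has at most two summands. -/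

import Mathlib

universe u v w

/-- An idempotent is primitive if it is nonzero and is not a sum of two nonzero
orthogonal idempotents. -/
def IsPrimitiveIdempotent {R : Type u} [Ring R] (e : R) : Prop :=
  IsIdempotentElem e ∧ e ≠ 0 ∧
    ∀ x y : R, IsIdempotentElem x → IsIdempotentElem y → x * y = 0 → y * x = 0 →
      x + y = e → x = 0 ∨ y = 0

/-- The set `f J e`, where `J` is the Jacobson radical of the ring. -/
def radicalCorner {R : Type u} [Ring R] (f e : R) : Set R :=
  {a | ∃ j ∈ Ring.jacobson R, a = f * j * e}

/-- The left module `Re / Ra`. It is formed as the quotient of the left ideal `Re` by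
`Ra ∩ Re`, which is `Ra` whenever `a ∈ Re`. -/
abbrev CyclicQuotient {R : Type u} [Ring R] (e a : R) : Type u :=
  ↥(Submodule.span R {e}) ⧸ (Submodule.span R {a}).submoduleOf (Submodule.span R {e})

/-- A module is uniserial if it has exactly one composition series (a finite chain of
submodules from `0` to the whole module with simple factors). -/
def IsUniserial (R : Type u) [Ring R] (M : Type v) [AddCommGroup M] [Module R M] : Prop :=
  ∃! s : CompositionSeries (Submodule R M), s.head = ⊥ ∧ s.last = ⊤

/-- A module is indecomposable if it is nonzero and is not the internal direct sum of two
nonzero submodules. -/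
def IsIndecomposableModule (R : Type u) [Ring R] (M : Type v) [AddCommGroup M]
    [Module R M] : Prop :=
  Nontrivial M ∧ ∀ N N' : Submodule R M, IsCompl N N' → N = ⊥ ∨ N' = ⊥

/-- `M` is a direct sum of exactly `n` indecomposable submodules. -/
def HasIndecomposableDecomposition (R : Type u) [Ring R] (M : Type v) [AddCommGroup M]
    [Module R M] (n : ℕ) : Prop :=
  ∃ N : Fin n → Submodule R M,
    DirectSum.IsInternal N ∧ ∀ i, IsIndecomposableModule R (N i)

/-- A homomorphism with a right inverse. -/
def IsSplitEpimorphism {R : Type u} [Ring R] {M : Type v} {N : Type w} [AddCommGroup M]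
    [Module R M] [AddCommGroup N] [Module R N] (g : M →ₗ[R] N) : Prop :=
  ∃ s : N →ₗ[R] M, g ∘ₗ s = LinearMap.id

/-- A homomorphism with a left inverse. -/
def IsSplitMonomorphism {R : Type u} [Ring R] {M : Type v} {N : Type w} [AddCommGroup M]
    [Module R M] [AddCommGroup N] [Module R N] (f : M →ₗ[R] N) : Prop :=
  ∃ r : N →ₗ[R] M, r ∘ₗ f = LinearMap.id

/-- `g : B → C` is right almost split in the category of finitely generated modules: it is
not a split epimorphism, and every homomorphism `X → C` from a finitely generated module that
is not a split epimorphism factors through `g`. (Every finitely generated module over `R` is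
isomorphic to one in the universe of `R`.) -/
def IsRightAlmostSplit {R : Type u} [Ring R] {B C : Type u} [AddCommGroup B] [Module R B]
    [AddCommGroup C] [Module R C] (g : B →ₗ[R] C) : Prop :=
  ¬ IsSplitEpimorphism g ∧
    ∀ (X : Type u) [AddCommGroup X] [Module R X] [Module.Finite R X] (h : X →ₗ[R] C),
      ¬ IsSplitEpimorphism h → ∃ h' : X →ₗ[R] B, g ∘ₗ h' = h

/-- `f : A → B` is left almost split in the category of finitely generated modules: it is
not a split monomorphism, and every homomorphism `A → Y` to a finitely generated module that
is not a split monomorphism factors through `f`. -/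
def IsLeftAlmostSplit {R : Type u} [Ring R] {A B : Type u} [AddCommGroup A] [Module R A]
    [AddCommGroup B] [Module R B] (f : A →ₗ[R] B) : Prop :=
  ¬ IsSplitMonomorphism f ∧
    ∀ (Y : Type u) [AddCommGroup Y] [Module R Y] [Module.Finite R Y] (h : A →ₗ[R] Y),
      ¬ IsSplitMonomorphism h → ∃ h' : B →ₗ[R] Y, h' ∘ₗ f = h

/-- `0 → A → B → C → 0` is an almost split sequence (Auslander–Reiten sequence) of finitely
generated modules. -/
structure IsAlmostSplitSequence {R : Type u} [Ring R] {A B C : Type u}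
    [AddCommGroup A] [Module R A] [AddCommGroup B] [Module R B]
    [AddCommGroup C] [Module R C] (f : A →ₗ[R] B) (g : B →ₗ[R] C) : Prop where
  finite_left : Module.Finite R A
  finite_middle : Module.Finite R B
  finite_right : Module.Finite R C
  injective : Function.Injective f
  exact : Function.Exact f g
  surjective : Function.Surjective g
  leftAlmostSplit : IsLeftAlmostSplit f
  rightAlmostSplit : IsRightAlmostSplit g

/-! Uniform dimension is subadditive along `0 → A → B → U → 0`, so it suffices that `A` and `U` are
uniform: then `B` contains no three independent nonzero submodules (`not_three_independent`), which
bounds its decompositions. The submodules of a uniserial `U` form a chain.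

For `A`, lift the generator `u` of `U` to `b` and let `x` be the element of `fA` with `i x = a b`.
Modulo `aA` it records the extension: `x ∉ aA` because the sequence does not split. For nonzero `S ≤
A`, left almost splitness extends `A → A/S` to `B`, so `x ∈ aA + S`. A functional `φ` killing `aA`
but not `x` is then nonzero on `fS` for every such `S`. Thus `y ↦ (r ↦ φ(f r y))` embeds `A` in the
dual of `fΛ`, and locality of `fΛf` makes `A` uniform. -/

/-- Any two nonzero submodules intersect nontrivially. -/
def IsUniformModule (R : Type u) [Ring R] (M : Type v) [AddCommGroup M] [Module R M] : Prop :=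
  ∀ N N' : Submodule R M, N ⊓ N' = ⊥ → N = ⊥ ∨ N' = ⊥

/-- Every submodule `N` refines to a composition series through `N`; by uniqueness that series is
`s`, so all submodules lie on one chain. -/
theorem IsUniserial.isUniformModule {R : Type u} [Ring R] {M : Type v} [AddCommGroup M]
    [Module R M] [IsNoetherian R M] [IsArtinian R M] (h : IsUniserial R M) :
    IsUniformModule R M := by
  obtain ⟨s, -, hs⟩ := h
  have mem : ∀ N : Submodule R M, ∃ j, s j = N := fun N ↦ by
    obtain ⟨t, j, hj, ht⟩ := LTSeries.exists_relSeries_covBy_and_head_eq_bot_and_last_eq_bot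
      (RelSeries.singleton {(a, b) : Submodule R M × Submodule R M | a < b} N)
    have hts : (t : CompositionSeries (Submodule R M)) = s := hs t ht
    subst hts
    exact ⟨j 0, congr_fun hj 0⟩
  intro N N' hN
  obtain ⟨j, rfl⟩ := mem N
  obtain ⟨k, rfl⟩ := mem N'
  rcases CompositionSeries.total (s := s) ⟨j, rfl⟩ ⟨k, rfl⟩ with h | h
  · left; rwa [inf_eq_left.2 h] at hN
  · right; rwa [inf_eq_right.2 h] at hN

/-! ### Uniform dimension of an extension and direct sum decompositions -/

/-- If the kernel and the range of `g` are uniform, then the source of `g` does not contain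
three independent nonzero submodules. -/
theorem not_three_independent {R : Type u} [Ring R] {A B C : Type u} [AddCommGroup A]
    [Module R A] [AddCommGroup B] [Module R B] [AddCommGroup C] [Module R C]
    {i : A →ₗ[R] B} {p : B →ₗ[R] C} (hi : Function.Injective i) (hip : Function.Exact i p)
    (hA : IsUniformModule R A) (hC : IsUniformModule R C)
    (N₀ N₁ N₂ : Submodule R B) (h₀₁ : N₀ ⊓ N₁ = ⊥) (h₂ : (N₀ ⊔ N₁) ⊓ N₂ = ⊥)
    (hN₀ : N₀ ≠ ⊥) (hN₁ : N₁ ≠ ⊥) (hN₂ : N₂ ≠ ⊥) : False := by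
  have hker : ∀ X Y : Submodule R B, X ⊓ Y = ⊥ → X ⊓ LinearMap.ker p ≠ ⊥ →
      Y ⊓ LinearMap.ker p = ⊥ := by
    intro X Y hXY hX
    have hr : LinearMap.ker p = LinearMap.range i := hip.linearMap_ker_eq
    rcases hA (X.comap i) (Y.comap i) (by
      rw [← Submodule.comap_inf, hXY]; exact LinearMap.ker_eq_bot.2 hi) with h | h
    · refine absurd ?_ hX
      rw [hr, inf_comm, ← Submodule.map_comap_eq, h, Submodule.map_bot]
    · rw [hr, inf_comm, ← Submodule.map_comap_eq, h, Submodule.map_bot]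
  -- Otherwise `X ⊔ Y` embeds in `C`, where `X` and `Y` have disjoint nonzero images.
  have hmap : ∀ X Y : Submodule R B, X ⊓ Y = ⊥ → X ≠ ⊥ → Y ≠ ⊥ →
      (X ⊔ Y) ⊓ LinearMap.ker p ≠ ⊥ := by
    intro X Y hXY hX hY h
    have key : ∀ z ∈ X ⊔ Y, p z = 0 → z = 0 := fun z hz hpz ↦ by
      have : z ∈ (X ⊔ Y) ⊓ LinearMap.ker p := ⟨hz, hpz⟩
      rwa [h, Submodule.mem_bot] at this
    have himg : ∀ Z ≤ X ⊔ Y, Z.map p = ⊥ → Z = ⊥ := fun Z hZ h0 ↦ by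
      rw [eq_bot_iff]
      intro z hz
      exact key z (hZ hz) ((Submodule.eq_bot_iff _).1 h0 _ ⟨z, hz, rfl⟩)
    rcases hC (X.map p) (Y.map p) (by
      rw [eq_bot_iff]
      rintro _ ⟨⟨x, hx, rfl⟩, y, hy, hxy⟩
      have hxy' : x - y = 0 := key _ (sub_mem (Submodule.mem_sup_left hx)
        (Submodule.mem_sup_right hy)) (by rw [map_sub, hxy, sub_self])
      have hx0 : x ∈ X ⊓ Y := ⟨hx, by rwa [sub_eq_zero.1 hxy']⟩
      rw [hXY, Submodule.mem_bot] at hx0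
      simp [hx0]) with h | h
    · exact hX (himg X le_sup_left h)
    · exact hY (himg Y le_sup_right h)
  have h₀₂ : N₀ ⊓ N₂ = ⊥ := eq_bot_iff.2 ((inf_le_inf_right _ le_sup_left).trans h₂.le)
  have h₁₂ : N₁ ⊓ N₂ = ⊥ := eq_bot_iff.2 ((inf_le_inf_right _ le_sup_right).trans h₂.le)
  have k₂ := hker _ _ h₂ (hmap _ _ h₀₁ hN₀ hN₁)
  have h₁ : (N₀ ⊔ N₂) ⊓ N₁ = ⊥ :=
    (((disjoint_iff.2 h₀₁).symm.disjoint_sup_right_of_disjoint_sup_left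
      (by rw [sup_comm]; exact disjoint_iff.2 h₂)).symm).eq_bot
  have k₁ := hker _ _ h₁ (hmap _ _ h₀₂ hN₀ hN₂)
  have hinj : ∀ X : Submodule R B, X ⊓ LinearMap.ker p = ⊥ → ∀ z ∈ X, p z = 0 → z = 0 :=
    fun X h z hz hpz ↦ by
      have : z ∈ X ⊓ LinearMap.ker p := ⟨hz, hpz⟩
      rwa [h, Submodule.mem_bot] at this
  have h₀ : (N₁ ⊔ N₂) ⊓ N₀ = ⊥ :=
    (((disjoint_iff.2 h₀₁).disjoint_sup_right_of_disjoint_sup_left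
      (disjoint_iff.2 h₂)).symm).eq_bot
  have k₀ := hker _ _ h₀ (hmap _ _ h₁₂ hN₁ hN₂)
  have hne : ∀ X : Submodule R B, X ≠ ⊥ → X ⊓ LinearMap.ker p = ⊥ → X.map p ≠ ⊥ := by
    intro X hX h h0
    refine hX ((Submodule.eq_bot_iff _).2 fun z hz ↦ hinj X h z hz ?_)
    exact (Submodule.eq_bot_iff _).1 h0 _ ⟨z, hz, rfl⟩
  have hV : N₀.map p ⊓ N₁.map p ⊓ N₂.map p ≠ ⊥ := fun h ↦ by
    rcases hC _ _ h with h | h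
    · rcases hC _ _ h with h | h
      exacts [hne _ hN₀ k₀ h, hne _ hN₁ k₁ h]
    · exact hne _ hN₂ k₂ h
  obtain ⟨v, ⟨⟨⟨n₀, hn₀, e₀⟩, n₁, hn₁, e₁⟩, n₂, hn₂, e₂⟩, hv⟩ :=
    Submodule.exists_mem_ne_zero_of_ne_bot hV
  -- All three submodules now embed in `C`, and `v` is a common nonzero image. Differences of its
  -- lifts come from `A`; a relation `r(n₀ - n₁) = s(n₁ - n₂)` forces `r n₀ = 0` by independence,
  -- then `r v = 0` and `r n₁ = 0`.
  have hd : ∀ z w, p z = v → p w = v → ∃ c, i c = z - w := fun z w hz hw ↦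
    (hip _).1 (by rw [map_sub, hz, hw, sub_self])
  obtain ⟨c, hc⟩ := hd n₀ n₁ e₀ e₁
  obtain ⟨d, hd⟩ := hd n₁ n₂ e₁ e₂
  rcases hA (Submodule.span R {c}) (Submodule.span R {d}) (by
    rw [eq_bot_iff]
    rintro z ⟨hz, hz'⟩
    obtain ⟨r, rfl⟩ := Submodule.mem_span_singleton.1 hz
    obtain ⟨s, hs⟩ := Submodule.mem_span_singleton.1 hz'
    have hs' := congrArg i hs
    rw [map_smul, map_smul, hc, hd, smul_sub, smul_sub] at hs'
    have hr : r • n₀ ∈ (N₁ ⊔ N₂) ⊓ N₀ := by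
      refine ⟨?_, N₀.smul_mem _ hn₀⟩
      have : r • n₀ = (s • n₁ + r • n₁) - s • n₂ := by
        rw [← eq_sub_iff_add_eq.1 hs']
        abel
      rw [this]
      exact sub_mem (Submodule.mem_sup_left (add_mem (N₁.smul_mem _ hn₁) (N₁.smul_mem _ hn₁)))
        (Submodule.mem_sup_right (N₂.smul_mem _ hn₂))
    rw [h₀, Submodule.mem_bot] at hr
    have hrv : r • v = 0 := by rw [← e₀, ← map_smul, hr, map_zero]
    have hr₁ : r • n₁ = 0 := hinj _ k₁ _ (N₁.smul_mem _ hn₁) (by rw [map_smul, e₁, hrv])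
    refine (Submodule.mem_bot R).2 (hi ?_)
    rw [map_smul, hc, smul_sub, hr, hr₁, sub_self, map_zero]) with h | h
  · rw [Submodule.span_singleton_eq_bot] at h
    rw [h, map_zero, eq_comm, sub_eq_zero] at hc
    have : n₀ ∈ N₀ ⊓ N₁ := ⟨hn₀, hc ▸ hn₁⟩
    rw [h₀₁, Submodule.mem_bot] at this
    exact hv (by rw [← e₀, this, map_zero])
  · rw [Submodule.span_singleton_eq_bot] at h
    rw [h, map_zero, eq_comm, sub_eq_zero] at hd
    have : n₁ ∈ N₁ ⊓ N₂ := ⟨hn₁, hd ▸ hn₂⟩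
    rw [h₁₂, Submodule.mem_bot] at this
    exact hv (by rw [← e₁, this, map_zero])

/-- If no three nonzero submodules of `M` are independent, then `M` is a direct sum of at most
two indecomposable submodules, and all its decompositions have at most two summands. -/
theorem decomposition_le_two {R : Type u} [Ring R] {M : Type v} [AddCommGroup M] [Module R M]
    (h : ∀ N₀ N₁ N₂ : Submodule R M, N₀ ⊓ N₁ = ⊥ → (N₀ ⊔ N₁) ⊓ N₂ = ⊥ →
      N₀ ≠ ⊥ → N₁ ≠ ⊥ → N₂ ≠ ⊥ → False) :
    (∃ n : ℕ, n ≤ 2 ∧ HasIndecomposableDecomposition R M n) ∧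
      ∀ n : ℕ, HasIndecomposableDecomposition R M n → n ≤ 2 := by
  constructor
  · rcases subsingleton_or_nontrivial M with hM | hM
    · refine ⟨0, by omega, Fin.elim0, ?_, fun j ↦ j.elim0⟩
      rw [DirectSum.isInternal_submodule_iff_iSupIndep_and_iSup_eq_top]
      exact ⟨fun j ↦ j.elim0, Subsingleton.elim _ _⟩
    by_cases hd : ∃ N N' : Submodule R M, IsCompl N N' ∧ N ≠ ⊥ ∧ N' ≠ ⊥
    · obtain ⟨N, N', hc, hN, hN'⟩ := hd
      -- A proper splitting of `N` would yield, together with `N'`, three independent submodules.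
      have indec : ∀ N N' : Submodule R M, IsCompl N N' → N ≠ ⊥ → N' ≠ ⊥ →
          IsIndecomposableModule R N := by
        intro N N' hc hN hN'
        refine ⟨Submodule.nontrivial_iff_ne_bot.2 hN, fun X Y hXY ↦ ?_⟩
        by_contra! hne
        have hm : ∀ Z : Submodule R N, Z ≠ ⊥ → Z.map N.subtype ≠ ⊥ := fun Z hZ h0 ↦
          hZ (Submodule.map_injective_of_injective N.injective_subtype
            (by rw [h0, Submodule.map_bot]))
        refine h (X.map N.subtype) (Y.map N.subtype) N' ?_ ?_ (hm X hne.1) (hm Y hne.2) hN'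
        · rw [← Submodule.map_inf _ N.injective_subtype, hXY.inf_eq_bot, Submodule.map_bot]
        · rw [← Submodule.map_sup, hXY.sup_eq_top, Submodule.map_subtype_top]
          exact hc.inf_eq_bot
      refine ⟨2, le_rfl, ![N, N'], ?_, fun j ↦ ?_⟩
      · rw [DirectSum.isInternal_submodule_iff_isCompl (i := 0) (j := 1) _ (by decide)
          (by ext j; fin_cases j <;> simp)]
        exact hc
      · fin_cases j
        · exact indec N N' hc hN hN'
        · exact indec N' N hc.symm hN' hN
    · push Not at hd
      refine ⟨1, by omega, fun _ ↦ ⊤, ?_, fun _ ↦ ⟨?_, fun X Y hXY ↦ ?_⟩⟩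
      · rw [DirectSum.isInternal_submodule_iff_iSupIndep_and_iSup_eq_top]
        exact ⟨iSupIndep_subsingleton _, by simp⟩
      · exact (Submodule.nontrivial_iff_ne_bot).2 top_ne_bot
      · have inj : Function.Injective (⊤ : Submodule R M).subtype := Submodule.injective_subtype _
        have := hd (X.map (⊤ : Submodule R M).subtype) (Y.map (⊤ : Submodule R M).subtype)
          (IsCompl.of_eq
            (by rw [← Submodule.map_inf _ inj, hXY.inf_eq_bot, Submodule.map_bot])
            (by rw [← Submodule.map_sup, hXY.sup_eq_top, Submodule.map_subtype_top]))
        have hm : ∀ Z : Submodule R (⊤ : Submodule R M),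
            Z.map (⊤ : Submodule R M).subtype = ⊥ → Z = ⊥ := fun Z h0 ↦
          Submodule.map_injective_of_injective inj (by rw [h0, Submodule.map_bot])
        by_cases hX : X = ⊥
        · exact .inl hX
        · exact .inr (hm Y (this fun h0 ↦ hX (hm X h0)))
  · rintro n ⟨N, hN, hind⟩
    by_contra! hn
    have hi := hN.submodule_iSupIndep
    have hne : ∀ j, N j ≠ ⊥ := fun j ↦ Submodule.nontrivial_iff_ne_bot.1 (hind j).1
    let j₀ : Fin n := ⟨0, by omega⟩
    let j₁ : Fin n := ⟨1, by omega⟩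
    let j₂ : Fin n := ⟨2, by omega⟩
    refine h (N j₀) (N j₁) (N j₂) ?_ ?_ (hne _) (hne _) (hne _)
    · exact (hi.pairwiseDisjoint (show j₀ ≠ j₁ by simp [j₀, j₁])).eq_bot
    · refine ((hi j₂).symm.mono_left (sup_le ?_ ?_)).eq_bot
      · exact le_iSup₂_of_le j₀ (by simp [j₀, j₂]) le_rfl
      · exact le_iSup₂_of_le j₁ (by simp [j₁, j₂]) le_rfl

/-! ### Primitive idempotents and uniform modules -/

/-- The corner ring of a primitive idempotent of a finite-dimensional algebra is local. -/
theorem IsPrimitiveIdempotent.exists_mul_eq {K : Type v} [Field K] {Λ : Type u} [Ring Λ]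
    [Algebra K Λ] [Module.Finite K Λ] {f : Λ} (hf : IsPrimitiveIdempotent f) {r : Λ}
    (hfr : f * r = r) (hrf : r * f = r) : (∃ t, r * t = f) ∨ ∃ t, (f - r) * t = f := by
  obtain ⟨hff, -, hprim⟩ := hf
  -- Fitting decomposition for left multiplication by `r`. The components `g`, `h` of `f` turn out
  -- to be orthogonal idempotents, since `g * h` and `h * g` lie in both the kernel and the range.
  obtain ⟨n, hc, hn⟩ := ((LinearMap.eventually_isCompl_ker_pow_range_pow
    (LinearMap.mulLeft K r)).and (Filter.eventually_ge_atTop 1)).exists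
  obtain ⟨m, rfl⟩ : ∃ m, n = m + 1 := ⟨n - 1, by omega⟩
  rw [LinearMap.pow_mulLeft] at hc
  obtain ⟨g, h, hg, hh, hgh⟩ : ∃ g h, r ^ (m + 1) * g = 0 ∧ (∃ t, r ^ (m + 1) * t = h) ∧
      g + h = f := by
    obtain ⟨g, hg, h, ⟨t, ht⟩, e⟩ :=
      Submodule.mem_sup.1 (hc.sup_eq_top ▸ Submodule.mem_top (x := f))
    exact ⟨g, h, by simpa using hg, ⟨t, by simpa using ht⟩, e⟩
  have zero : ∀ z, r ^ (m + 1) * z = 0 → (∃ t, r ^ (m + 1) * t = z) → z = 0 := by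
    rintro z hz ⟨t, ht⟩
    have : z ∈ LinearMap.ker (LinearMap.mulLeft K (r ^ (m + 1))) ⊓
        LinearMap.range (LinearMap.mulLeft K (r ^ (m + 1))) :=
      ⟨by simpa using hz, t, by simpa using ht⟩
    rwa [hc.inf_eq_bot, Submodule.mem_bot] at this
  obtain ⟨t, ht⟩ := hh
  have hfh : f * h = h := by rw [← ht, pow_succ', mul_assoc, ← mul_assoc, hfr]
  have hfg : f * g = g := by
    rw [eq_sub_of_add_eq hgh, mul_sub, hff.eq, hfh]
  have e1 : g * h = h - h * h := by rw [eq_sub_of_add_eq hgh, sub_mul, hfh]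
  have e2 : h * g = g - g * g := by rw [eq_sub_of_add_eq' hgh, sub_mul, hfg]
  have gh0 : g * h = 0 := zero _ (by rw [← mul_assoc, hg, zero_mul])
    ⟨t - t * h, by rw [mul_sub, ← mul_assoc, ht, e1]⟩
  have hg0 : h * g = 0 := zero _ (by rw [e2, mul_sub, ← mul_assoc, hg, zero_mul, sub_zero])
    ⟨t * g, by rw [← mul_assoc, ht]⟩
  rcases hprim g h (sub_eq_zero.1 (e2 ▸ hg0)).symm (sub_eq_zero.1 (e1 ▸ gh0)).symm gh0 hg0 hgh
    with h0 | h0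
  · left
    refine ⟨r ^ m * t, ?_⟩
    rw [← mul_assoc, ← pow_succ', ht, ← hgh, h0, zero_add]
  · right
    rw [h0, add_zero] at hgh
    have hr0 : r ^ (m + 1) = 0 := by
      rw [hgh, pow_succ, mul_assoc, hrf, ← pow_succ] at hg
      exact hg
    -- Here `r` is nilpotent, so the geometric series inverts `1 - r`.
    refine ⟨(∑ k ∈ Finset.range (m + 1), r ^ k) * f, ?_⟩
    have : f - r = f * (1 - r) := by rw [mul_sub, mul_one, hfr]
    rw [this, mul_assoc, ← mul_assoc (1 - r), mul_neg_geom_sum, hr0, sub_zero, one_mul, hff.eq]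

/-- A module is uniform if it carries a functional which vanishes on no `f`-part of a nonzero
submodule, where `f` is a primitive idempotent. -/
theorem IsPrimitiveIdempotent.isUniformModule {K : Type v} [Field K] {Λ : Type u} [Ring Λ]
    [Algebra K Λ] [Module.Finite K Λ] {f : Λ} (hf : IsPrimitiveIdempotent f)
    {A : Type w} [AddCommGroup A] [Module Λ A] [Module K A] [IsScalarTower K Λ A]
    [Module.Finite K A] (φ : Module.Dual K A)
    (hφ : ∀ S : Submodule Λ A, S ≠ ⊥ → ∃ s ∈ S, φ (f • s) ≠ 0) : IsUniformModule Λ A := by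
  intro S T hST
  by_contra! hne
  have : SMulCommClass K Λ A := IsScalarTower.to_smulCommClass
  let m : Λ → A →ₗ[K] A := fun r ↦ Module.toModuleEnd K A r
  let F : Λ →ₗ[K] Module.Dual K A :=
    { toFun := fun r ↦ φ ∘ₗ m (f * r)
      map_add' := fun r s ↦ by ext y; simp [m, mul_add, add_smul]
      map_smul' := fun c r ↦ by ext y; simp [m] }
  have hF : ∀ r y, F r y = φ ((f * r) • y) := fun r y ↦ rfl
  -- By `hφ`, no nonzero vector is killed by all `F r`; in finite dimension this means that `F` is
  -- onto.
  have hsurj : LinearMap.range F = ⊤ := by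
    have hbot : (LinearMap.range F).dualCoannihilator = ⊥ := by
      rw [eq_bot_iff]
      intro y hy
      rw [Submodule.mem_dualCoannihilator] at hy
      by_contra hy0
      obtain ⟨s, hs, hs0⟩ := hφ (Submodule.span Λ {y}) (by simpa using hy0)
      obtain ⟨r, rfl⟩ := Submodule.mem_span_singleton.1 hs
      exact hs0 (by rw [smul_smul, ← hF]; exact hy _ ⟨r, rfl⟩)
    rw [← Subspace.dualCoannihilator_dualAnnihilator_eq (W := LinearMap.range F), hbot,
      Submodule.dualAnnihilator_bot]
  have hdisj : Disjoint (S.restrictScalars K) (T.restrictScalars K) :=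
    Submodule.disjoint_def.2 fun z hz hz' ↦ by
      have : z ∈ S ⊓ T := ⟨hz, hz'⟩
      rwa [hST, Submodule.mem_bot] at this
  obtain ⟨C, hSC, hC⟩ := hdisj.exists_isCompl
  -- Some `f * r` imitates `f` on `S` and zero on `T` as seen by `φ`. Locality makes `f r f` or `f -
  -- f r f` right invertible, so `φ` vanishes on `fT` or on `fS`.
  obtain ⟨r, hr⟩ : (φ ∘ₗ m f) ∘ₗ Submodule.projection _ _ hC ∈ LinearMap.range F := hsurj ▸ Submodule.mem_top
  have hrS : ∀ y ∈ S, φ ((f * r) • y) = φ (f • y) := fun y hy ↦ by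
    rw [← hF, hr]
    simp [m, Submodule.projection_apply_of_mem_left hC (hSC hy)]
  have hrT : ∀ y ∈ T, φ ((f * r) • y) = 0 := fun y hy ↦ by
    rw [← hF, hr]
    simp [m, Submodule.projection_apply_of_mem_right hC hy]
  have hff := hf.1
  rcases hf.exists_mul_eq (K := K) (r := f * r * f) (by simp only [← mul_assoc, hff.eq])
    (by rw [mul_assoc, hff.eq]) with ⟨t, ht⟩ | ⟨t, ht⟩
  · obtain ⟨s, hs, hs0⟩ := hφ T hne.2
    refine hs0 ?_
    rw [← ht, mul_assoc, mul_smul]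
    exact hrT _ (T.smul_mem _ hs)
  · obtain ⟨s, hs, hs0⟩ := hφ S hne.1
    refine hs0 ?_
    have hft : f = f * (f * t) - f * r * (f * t) := by
      rw [← mul_assoc, hff.eq, ← mul_assoc, ← sub_mul, ht]
    rw [hft, sub_smul, map_sub, mul_smul f, mul_smul (f * r), hrS _ (S.smul_mem _ hs), sub_self]

/-! ### Uniformity of the left-hand term -/

/-- If `i : A → B` is left almost split, with cokernel the nonsplit extension
`p : B → Λe / Λa`, then `A` is uniform. -/
theorem isUniformModule_left {K : Type v} [Field K] {Λ : Type u} [Ring Λ] [Algebra K Λ]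
    [Module.Finite K Λ] {e f a : Λ} (he : IsIdempotentElem e) (hf : IsPrimitiveIdempotent f)
    (hfa : f * a = a) (hae : a * e = a)
    {A B : Type u} [AddCommGroup A] [Module Λ A] [Module.Finite Λ A] [AddCommGroup B] [Module Λ B]
    {i : A →ₗ[Λ] B} {p : B →ₗ[Λ] CyclicQuotient e a} (hinj : Function.Injective i)
    (hex : Function.Exact i p) (hsurj : Function.Surjective p) (hi : IsLeftAlmostSplit i)
    (hp : ¬ IsSplitEpimorphism p) : IsUniformModule Λ A := by
  let u : CyclicQuotient e a :=
    Submodule.Quotient.mk ⟨e, Submodule.mem_span_singleton_self e⟩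
  have hu : ∀ r (hr : r ∈ Submodule.span Λ {e}),
      (Submodule.Quotient.mk ⟨r, hr⟩ : CyclicQuotient e a) = r • u := fun r hr ↦ by
    rw [← Submodule.Quotient.mk_smul]
    congr 1
    obtain ⟨s, rfl⟩ := Submodule.mem_span_singleton.1 hr
    exact Subtype.ext (by simp [mul_assoc, he.eq])
  have heu : e • u = u := (hu e _).symm
  have hau : a • u = 0 := by
    rw [← hu a (Submodule.mem_span_singleton.2 ⟨a, hae⟩), Submodule.Quotient.mk_eq_zero]
    exact Submodule.mem_span_singleton_self a
  obtain ⟨b, hb⟩ := hsurj u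
  obtain ⟨x, hx⟩ := (hex (a • b)).1 (by rw [map_smul, hb, hau])
  have hfx : f • x = x := hinj (by rw [map_smul, hx, smul_smul, hfa])
  have hxa : ∀ y, a • y ≠ x := by
    rintro y rfl
    -- If `x = a y`, then `a` kills `b - i y`, so `u ↦ e(b - i y)` splits `p`.
    refine hp ⟨Submodule.liftQ _ (LinearMap.toSpanSingleton Λ B (e • (b - i y)) ∘ₗ
      (Submodule.span Λ {e}).subtype) ?_, ?_⟩
    · rintro ⟨r, hr⟩ hra
      obtain ⟨s, rfl⟩ := Submodule.mem_span_singleton.1 (show r ∈ Submodule.span Λ {a} from hra)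
      change (s * a) • (e • (b - i y)) = 0
      rw [smul_smul, mul_assoc, hae, mul_smul, smul_sub a, ← hx, map_smul, sub_self, smul_zero]
    · refine LinearMap.ext fun z ↦ ?_
      obtain ⟨⟨r, hr⟩, rfl⟩ := Submodule.Quotient.mk_surjective _ z
      have hpi : p (i y) = 0 := hex.apply_apply_eq_zero y
      change p (r • (e • (b - i y))) = (Submodule.Quotient.mk ⟨r, hr⟩ : CyclicQuotient e a)
      rw [map_smul, map_smul, map_sub, hpi, sub_zero, hb, heu, hu]
  let _ : Module K A := Module.compHom A (algebraMap K Λ)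
  have : IsScalarTower K Λ A := ⟨fun c r y ↦ by
    rw [Algebra.smul_def, mul_smul]; rfl⟩
  have : SMulCommClass K Λ A := IsScalarTower.to_smulCommClass
  have : Module.Finite K A := Module.Finite.trans Λ A
  obtain ⟨φ, hφx, hφa⟩ := Submodule.exists_le_ker_of_notMem
    (p := LinearMap.range (Module.toModuleEnd K A a)) (v := x) (by
      rintro ⟨y, hy⟩
      exact hxa y hy)
  refine hf.isUniformModule φ fun S hS ↦ ?_
  obtain ⟨h', hh'⟩ := hi.2 (A ⧸ S) S.mkQ (by
    rintro ⟨r, hr⟩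
    refine hS ((Submodule.eq_bot_iff _).2 fun s hs ↦ ?_)
    have := LinearMap.congr_fun hr s
    simpa [(Submodule.Quotient.mk_eq_zero S).2 hs] using this.symm)
  -- Since `i x = a b`, applying `h'` shows that `x` and `a y` agree modulo `S`.
  obtain ⟨y, hy⟩ := S.mkQ_surjective (h' b)
  have hs : x - a • y ∈ S := by
    rw [← Submodule.Quotient.mk_eq_zero, ← Submodule.mkQ_apply, map_sub, map_smul, hy, ← map_smul,
      ← hx, ← hh', LinearMap.comp_apply, sub_self]
  refine ⟨_, hs, ?_⟩
  have hφy : φ (a • y) = 0 := hφa ⟨y, rfl⟩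
  rwa [smul_sub, smul_smul, hfa, hfx, map_sub, hφy, sub_zero]

theorem mainTheorem11 {K : Type v} [Field K] {Λ : Type u} [Ring Λ] [Algebra K Λ]
    [Module.Finite K Λ] (e f a : Λ) (he : IsPrimitiveIdempotent e)
    (hf : IsPrimitiveIdempotent f) (ha : a ∈ radicalCorner f e) (ha0 : a ≠ 0)
    (hU : IsUniserial Λ (CyclicQuotient e a))
    {A B : Type u} [AddCommGroup A] [Module Λ A] [AddCommGroup B] [Module Λ B]
    (i : A →ₗ[Λ] B) (p : B →ₗ[Λ] CyclicQuotient e a) (hip : IsAlmostSplitSequence i p) :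
    (∃ n : ℕ, n ≤ 2 ∧ HasIndecomposableDecomposition Λ B n) ∧
      ∀ n : ℕ, HasIndecomposableDecomposition Λ B n → n ≤ 2 := by
  obtain ⟨j, -, rfl⟩ := ha
  have := hip.finite_left
  have := hip.finite_right
  have : IsArtinianRing Λ := IsArtinianRing.of_finite K Λ
  have : IsNoetherianRing Λ := IsNoetherianRing.of_finite K Λ
  have hA := isUniformModule_left (K := K) he.1 hf
    (show f * (f * j * e) = f * j * e by simp only [← mul_assoc, hf.1.eq])
    (show f * j * e * e = f * j * e by rw [mul_assoc, he.1.eq]) hip.injective hip.exact hip.surjective hip.leftAlmostSplit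
    hip.rightAlmostSplit.1
  exact decomposition_le_two
    (not_three_independent hip.injective hip.exact hA hU.isUniformModule)
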